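/- Let $n\ge 2$, $\lambda>1$, $\nu=\sqrt{\lambda^2-1}$ and $C(\lambda)=\lambda\nu^{n-1}$. Write $x=(x_1,\tilde x,x_n)\in\mathbb R\times\mathbb R^{n-2}\times\mathbb R$ for points of $\mathbb R^n$ and $u=(u_1,\tilde u)\in\mathbb R\times\mathbb R^{n-2}$ for points of $\mathbb R^{n-1}$, and put $$ q(u,x)=\frac{(u_1-x_1)^2}{\lambda^2}+\frac{|\tilde u-\tilde x|^2}{\nu^2}+\frac{x_n^2}{\nu^2}. $$ For $u\in\mathbb R^{n-1}$ and $t>0$ let $E_{u,t}=\{x\in\mathbb R^n: q(u,x)\le t^2\}$. For locally integrable $h:\mathbb R^n\to\mathbb R$ let $R_Eh(u,t)=\int_{E_{u,t}}h(x)\,dx$ (the elliptical Radon transform), and for $\phi:\mathbb R^{n-1}\times[0,\infty)\to\mathbb R$ let $R_E^*\phi(x)=\int_{\mathbb R^{n-1}}\phi\bigl(u,\sqrt{q(u,x)}\bigr)\,du$ (the back projection). Let $\phi\in C_c^\infty(\mathbb R^{n-1}\times[0,\infty))$ be real-valued (smooth up to the boundary, with compact support that may meet the boundary), and let $f\in C_c^\infty(\mathbb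 R^n)$ be real-valued and even in $x_n$. Put $$ \psi=R_E^*\phi,\qquad g(u,t)=\frac1{t^{n-1}}\frac{\partial}{\partial t}R_Ef(u,t)\quad(t>0). $$ Then the integrals defining $\psi$ and $f*\psi$ (the usual convolution $f*\psi(x)=\int_{\mathbb R^n}f(y)\psi(x-y)\,dy$) converge absolutely, $f*\psi$ is locally integrable, $R_Ef$ and $R_E(f*\psi)$ are differentiable in $t>0$, and for every $u\in\mathbb R^{n-1}$ and every $\omega\in\mathbb R^n\setminus\{0\}$, with $t=|\omega|$, the double integral $$ (g*\phi)(u,|\omega|)=\int_{\mathbb R^n}\int_{\mathbb R^{n-1}}g(u-u',|\omega-\omega'|)\,\phi(u',|\omega'|)\,du'\,d\omega' $$ converges absolutely and $$ (g*\phi)(u,t)=\frac{1}{C(\lambda)\,t^{n-1}}\,\frac{\partial}{\partial t}R_E(f*\psi)(u,t). $$ -/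

import Mathlib

open MeasureTheory Set
open scoped ContDiff

namespace EllipticalRadon

noncomputable section

/-- `ν = √(λ² - 1)`. -/
def nu (lam : ℝ) : ℝ := Real.sqrt (lam ^ 2 - 1)

/-- The scale of the `i`-th coordinate direction (counted from `0`): `λ` for the first coordinate,
`ν` for all the others. -/
def axisScale (lam : ℝ) (i : ℕ) : ℝ := if i = 0 then lam else nu lam

/-- `(u₁ - x₁)² / λ² + |ũ - x̃|² / ν² + xₙ² / ν²` for `u ∈ ℝⁿ⁻¹`, `x ∈ ℝⁿ`, where `n = m + 1`. -/
def quadForm {m : ℕ} (lam : ℝ) (u : EuclideanSpace ℝ (Fin m))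
    (x : EuclideanSpace ℝ (Fin (m + 1))) : ℝ :=
  (∑ i : Fin m, (u i - x i.castSucc) ^ 2 / axisScale lam i ^ 2)
    + x (Fin.last m) ^ 2 / nu lam ^ 2

/-- The solid ellipsoid `E_{u,t}` with centre `(u, 0)` and half focal distance `t`. -/
def solidEllipsoid {m : ℕ} (lam : ℝ) (u : EuclideanSpace ℝ (Fin m)) (t : ℝ) :
    Set (EuclideanSpace ℝ (Fin (m + 1))) :=
  {x | quadForm lam u x ≤ t ^ 2}

/-- The elliptical Radon transform `R_E f (u, t)`: the volume integral of `f` over `E_{u,t}`. -/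
def radonE {m : ℕ} (lam : ℝ) (f : EuclideanSpace ℝ (Fin (m + 1)) → ℝ)
    (p : EuclideanSpace ℝ (Fin m) × ℝ) : ℝ :=
  ∫ x in solidEllipsoid lam p.1 p.2, f x

/-- The partial derivative `∂_t h (u, t)`. -/
def partialT {m : ℕ} (h : EuclideanSpace ℝ (Fin m) × ℝ → ℝ)
    (p : EuclideanSpace ℝ (Fin m) × ℝ) : ℝ :=
  deriv (fun s : ℝ => h (p.1, s)) p.2

/-- The normalized derivative `t^{1-n} ∂_t R_E f (u, t)`, where `n = m + 1`. -/
def radonData {m : ℕ} (lam : ℝ) (f : EuclideanSpace ℝ (Fin (m + 1)) → ℝ)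
    (p : EuclideanSpace ℝ (Fin m) × ℝ) : ℝ :=
  1 / p.2 ^ m * partialT (radonE lam f) p

/-- The back projection `R_E^* φ`. -/
def backProj {m : ℕ} (lam : ℝ) (φ : EuclideanSpace ℝ (Fin m) × ℝ → ℝ)
    (x : EuclideanSpace ℝ (Fin (m + 1))) : ℝ :=
  ∫ u : EuclideanSpace ℝ (Fin m), φ (u, Real.sqrt (quadForm lam u x))

/-- The Jacobian factor `C(λ) = λ ν^{n-1}`, where `n = m + 1`. -/
def jacobian (m : ℕ) (lam : ℝ) : ℝ := lam * nu lam ^ m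

/-- The convolution of functions on `ℝⁿ` with respect to Lebesgue measure. -/
def conv {m : ℕ} (f ψ : EuclideanSpace ℝ (Fin (m + 1)) → ℝ) :
    EuclideanSpace ℝ (Fin (m + 1)) → ℝ :=
  convolution f ψ (ContinuousLinearMap.mul ℝ ℝ) volume

/-- The integrand of the convolution `g * φ`, where the second variable of `g` and of `φ`
is read as the length of a vector of `ℝⁿ`. -/
def radialConvKernel {m : ℕ} (g φ : EuclideanSpace ℝ (Fin m) × ℝ → ℝ)
    (u : EuclideanSpace ℝ (Fin m)) (w : EuclideanSpace ℝ (Fin (m + 1)))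
    (w' : EuclideanSpace ℝ (Fin (m + 1))) (u' : EuclideanSpace ℝ (Fin m)) : ℝ :=
  g (u - u', ‖w - w'‖) * φ (u', ‖w'‖)

/-- The convolution `(g * φ)(u, |ω|)`, in `u ∈ ℝⁿ⁻¹` and radially in `ω ∈ ℝⁿ`. -/
def radialConv {m : ℕ} (g φ : EuclideanSpace ℝ (Fin m) × ℝ → ℝ)
    (u : EuclideanSpace ℝ (Fin m)) (w : EuclideanSpace ℝ (Fin (m + 1))) : ℝ :=
  ∫ w' : EuclideanSpace ℝ (Fin (m + 1)), ∫ u' : EuclideanSpace ℝ (Fin m),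
    radialConvKernel g φ u w w' u'

/-- The closed half space `ℝⁿ⁻¹ × [0, ∞)`. -/
def halfSpace (m : ℕ) : Set (EuclideanSpace ℝ (Fin m) × ℝ) := univ ×ˢ Ici 0

/-- `φ ∈ C_c^∞(ℝⁿ⁻¹ × [0, ∞))`: smooth up to the boundary `t = 0`, with compact support
(which may meet the boundary). The values at `t < 0` play no role. -/
def IsTestFunctionOnHalfSpace {m : ℕ} (φ : EuclideanSpace ℝ (Fin m) × ℝ → ℝ) : Prop :=
  ContDiffOn ℝ ∞ φ (halfSpace m) ∧
    ∃ K : Set (EuclideanSpace ℝ (Fin m) × ℝ), IsCompact K ∧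
      ∀ p ∈ halfSpace m, p ∉ K → φ p = 0

/-- `f` is even in the last variable `xₙ`. -/
def IsEvenInLast {m : ℕ} (f : EuclideanSpace ℝ (Fin (m + 1)) → ℝ) : Prop :=
  ∀ x y : EuclideanSpace ℝ (Fin (m + 1)), (∀ i : Fin m, y i.castSucc = x i.castSucc) →
    y (Fin.last m) = -x (Fin.last m) → f y = f x

end

end EllipticalRadon

namespace EllipticalRadon

/-! In the coordinates `x = (u, 0) + A z` with `A = diag(λ, ν, …, ν)`, the solid `E_{u,t}` is the
ball `|z| ≤ t` and Lebesgue measure gains the factor `det A = C(λ)`. Hence `∂_t R_E h (u, t) = C(λ)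
t^{n-1} M h (u, t)`, where `M` (`ellipsoidalIntegral`) integrates `h` over the image of the sphere
of radius `t` (`hasDerivAt_radonE`). So `g = C(λ) M f`, and the claim becomes `(g * φ)(u, |ω|) = M
(f * ψ)(u, |ω|)`, which is `radialConv_eq`.

The coordinates are affine with linear part independent of the centre, so the difference of the
points with centres `u`, `u - u'` and coordinates `w`, `z` has centre `u'` and coordinate `w - z`.
This turns `f * ψ` into `C(λ) ∫∫ f(P_{u-u'} z) φ(u', |w - z|) dz du'`, where `P_u z = (u, 0) + A z`
(`conv_ellipsoidPoint`). It remains to average over `w` on a sphere: by rotation invariance, the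
spherical average can be moved from the kernel `φ(u', |w - z|)` onto `f`, for each fixed `u'`
(`integral_sphericalMean_mul`). -/

theorem norm_smul_sub_smul_comm {E : Type*} [NormedAddCommGroup E] [InnerProductSpace ℝ E]
    {a b : E} (hab : ‖a‖ = ‖b‖) (s t : ℝ) :
    ‖s • a - t • b‖ = ‖t • a - s • b‖ := by
  rw [← sq_eq_sq₀ (norm_nonneg _) (norm_nonneg _), norm_sub_sq_real, norm_sub_sq_real]
  simp only [norm_smul, inner_smul_left, inner_smul_right, mul_pow, hab]
  simp
  ring

/-! ### Polar coordinates and rotation invariance on the sphere. -/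

section Sphere

open Metric
open scoped Pointwise

variable {E : Type*} [NormedAddCommGroup E] [InnerProductSpace ℝ E] [MeasurableSpace E]
  [BorelSpace E] [FiniteDimensional ℝ E]

/-- Integration in polar coordinates. -/
theorem integral_polar [Nontrivial E] {h : E → ℝ} (hi : Integrable h) :
    ∫ x, h x = ∫ r in Ioi (0 : ℝ), r ^ (Module.finrank ℝ E - 1) *
      ∫ θ : sphere (0 : E) 1, h (r • (θ : E)) ∂(volume : Measure E).toSphere := by
  set μ : Measure E := volume
  have hmp := (μ.measurePreserving_homeomorphUnitSphereProd)
  have hemb := (homeomorphUnitSphereProd E).measurableEmbedding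
  let H : sphere (0 : E) 1 × Ioi (0 : ℝ) → ℝ := fun p => h ((p.2 : ℝ) • (p.1 : E))
  have hH : ∀ x : ({0}ᶜ : Set E), H (homeomorphUnitSphereProd E x) = h x := by
    intro x
    have hx : ‖(x : E)‖ ≠ 0 := norm_ne_zero_iff.2 x.2
    simp [H, homeomorphUnitSphereProd, smul_smul, hx]
  have hHi : Integrable H (μ.toSphere.prod (.volumeIoiPow (Module.finrank ℝ E - 1))) := by
    rw [← hmp.integrable_comp_emb hemb]
    have : H ∘ homeomorphUnitSphereProd E = h ∘ (Subtype.val : ({0}ᶜ : Set E) → E) :=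
      funext hH
    rw [this, ← integrableOn_iff_comap_subtypeVal (measurableSet_singleton _).compl]
    exact hi.integrableOn
  calc ∫ x, h x = ∫ x : ({0}ᶜ : Set E), h x ∂(μ.comap (↑)) := by
        rw [integral_subtype_comap (measurableSet_singleton _).compl h,
          restrict_compl_singleton]
    _ = ∫ p, H p ∂μ.toSphere.prod (.volumeIoiPow (Module.finrank ℝ E - 1)) := by
        rw [← hmp.integral_comp hemb]
        exact integral_congr_ae (.of_forall fun x => (hH x).symm)
    _ = ∫ r, ∫ θ, H (θ, r) ∂μ.toSphere ∂(.volumeIoiPow (Module.finrank ℝ E - 1)) :=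
        integral_prod_symm _ hHi
    _ = _ := by
        simp only [Measure.volumeIoiPow, ENNReal.ofReal]
        rw [integral_withDensity_eq_integral_smul
          (measurable_subtype_coe.pow_const _).real_toNNReal]
        rw [integral_subtype_comap measurableSet_Ioi fun a : ℝ =>
          Real.toNNReal (a ^ (Module.finrank ℝ E - 1)) •
            ∫ θ : sphere (0 : E) 1, h (a • (θ : E)) ∂μ.toSphere]
        refine setIntegral_congr_fun measurableSet_Ioi fun x hx => ?_
        simp only [NNReal.smul_def, smul_eq_mul]
        rw [Real.coe_toNNReal _ (pow_nonneg (le_of_lt hx) _)]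

/-- The homeomorphism of the unit sphere induced by a linear isometry. -/
def sphereHomeomorph (R : E ≃ₗᵢ[ℝ] E) : sphere (0 : E) 1 ≃ₜ sphere (0 : E) 1 where
  toFun θ := ⟨R θ, by simp⟩
  invFun θ := ⟨R.symm θ, by simp⟩
  left_inv θ := by simp
  right_inv θ := by simp
  continuous_toFun := by fun_prop
  continuous_invFun := by fun_prop

/-- The surface measure of `s` is a multiple of the volume of the cone `(0, 1) • s`; a linear
isometry commutes with forming cones and preserves volume. -/
theorem measurePreserving_sphereHomeomorph (R : E ≃ₗᵢ[ℝ] E) :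
    MeasurePreserving (sphereHomeomorph R) (volume : Measure E).toSphere
      (volume : Measure E).toSphere := by
  refine ⟨(sphereHomeomorph R).measurable, Measure.ext fun s hs => ?_⟩
  rw [Measure.map_apply (sphereHomeomorph R).measurable hs,
    Measure.toSphere_apply' _ ((sphereHomeomorph R).measurable hs), Measure.toSphere_apply' _ hs]
  congr 1
  have : Ioo (0 : ℝ) 1 • ((↑) '' (sphereHomeomorph R ⁻¹' s) : Set E) =
      R ⁻¹' (Ioo (0 : ℝ) 1 • ((↑) '' s)) := by
    ext x
    simp only [Set.mem_smul, mem_image, mem_preimage]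
    constructor
    · rintro ⟨c, hc, _, ⟨θ, hθ, rfl⟩, rfl⟩
      exact ⟨c, hc, _, ⟨_, hθ, rfl⟩, by simp [sphereHomeomorph]⟩
    · rintro ⟨c, hc, _, ⟨θ, hθ, rfl⟩, h⟩
      refine ⟨c, hc, _, ⟨(sphereHomeomorph R).symm θ, by simpa using hθ, rfl⟩, ?_⟩
      apply R.injective
      rw [← h]
      simp [sphereHomeomorph]
  rw [this]
  exact R.measurePreserving.measure_preimage_equiv (f := R.toMeasurableEquiv) _

theorem integral_sphere_comp_isometry (R : E ≃ₗᵢ[ℝ] E) (h : E → ℝ) :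
    ∫ θ : sphere (0 : E) 1, h (R θ) ∂(volume : Measure E).toSphere =
      ∫ θ : sphere (0 : E) 1, h θ ∂(volume : Measure E).toSphere :=
  (measurePreserving_sphereHomeomorph R).integral_comp
    (sphereHomeomorph R).measurableEmbedding (fun θ => h θ)

/-- A spherical integral of a function of the distance to `w` only depends on `‖w‖`. -/
theorem integral_sphere_norm_sub_eq (k : ℝ → ℝ) (r : ℝ) {v w : E} (hvw : ‖v‖ = ‖w‖) :
    ∫ θ : sphere (0 : E) 1, k ‖v - r • (θ : E)‖ ∂(volume : Measure E).toSphere =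
      ∫ θ : sphere (0 : E) 1, k ‖w - r • (θ : E)‖ ∂(volume : Measure E).toSphere := by
  -- The reflection in the hyperplane orthogonal to `v - w` carries `v` to `w`, the two norms being
  -- equal.
  let R : E ≃ₗᵢ[ℝ] E := Submodule.reflection (Submodule.span ℝ {v - w})ᗮ
  have hR : R v = w := Submodule.reflection_sub hvw
  rw [← integral_sphere_comp_isometry R fun x => k ‖w - r • x‖]
  refine integral_congr_ae (.of_forall fun θ => ?_)
  simp only
  rw [← hR, ← map_smul, ← map_sub, R.norm_map]

/-- Continuity of spherical integrals depending on a parameter. -/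
theorem continuous_integral_sphere {X : Type*} [TopologicalSpace X] [FirstCountableTopology X]
    [LocallyCompactSpace X] {F : X → E → ℝ} (hF : Continuous F.uncurry) :
    Continuous fun x =>
      ∫ θ : sphere (0 : E) 1, F x θ ∂(volume : Measure E).toSphere := by
  have h := continuous_parametric_integral_of_continuous (μ := (volume : Measure E).toSphere)
    (f := fun x (θ : sphere (0 : E) 1) => F x θ)
    (hF.comp (continuous_fst.prodMk (continuous_subtype_val.comp continuous_snd))) isCompact_univ
  simpa using h

end Sphere

/-! ### Differentiation of ball integrals, and the exchange of spherical means. -/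

section Sphere

open Metric

variable {E : Type*} [NormedAddCommGroup E] [InnerProductSpace ℝ E] [MeasurableSpace E]
  [BorelSpace E] [FiniteDimensional ℝ E]

/-- In polar coordinates the ball integral is `∫₀ˢ M` with `M` continuous, so the fundamental
theorem of calculus applies. -/
theorem hasDerivAt_integral_closedBall [Nontrivial E] {h : E → ℝ} (hc : Continuous h)
    {t : ℝ} (ht : 0 < t) :
    HasDerivAt (fun s => ∫ x in closedBall (0 : E) s, h x)
      (t ^ (Module.finrank ℝ E - 1) *
        ∫ θ : sphere (0 : E) 1, h (t • (θ : E)) ∂(volume : Measure E).toSphere) t := by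
  let M : ℝ → ℝ := fun r => r ^ (Module.finrank ℝ E - 1) *
    ∫ θ : sphere (0 : E) 1, h (r • (θ : E)) ∂(volume : Measure E).toSphere
  have hM : Continuous M := by
    refine (continuous_id.pow _).mul
      (continuous_integral_sphere (F := fun (r : ℝ) (x : E) => h (r • x)) ?_)
    exact hc.comp (continuous_fst.smul continuous_snd)
  have key : ∀ s, 0 < s → ∫ x in closedBall (0 : E) s, h x = ∫ r in (0 : ℝ)..s, M r := by
    intro s hs
    have hi : Integrable ((closedBall (0 : E) s).indicator h) :=
      (hc.continuousOn.integrableOn_compact (isCompact_closedBall _ _)).integrable_indicator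
        measurableSet_closedBall
    rw [← integral_indicator measurableSet_closedBall, integral_polar hi,
      intervalIntegral.integral_of_le hs.le, ← Ioi_inter_Iic,
      ← setIntegral_indicator measurableSet_Iic]
    refine setIntegral_congr_fun measurableSet_Ioi fun r hr => ?_
    have hr : 0 < r := hr
    by_cases hrs : r ≤ s
    · have : ∀ θ : sphere (0 : E) 1, r • (θ : E) ∈ closedBall (0 : E) s := fun θ => by
        simpa [norm_smul, abs_of_pos hr] using hrs
      simp [M, hrs, this]
    · have : ∀ θ : sphere (0 : E) 1, r • (θ : E) ∉ closedBall (0 : E) s := fun θ => by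
        simpa [norm_smul, abs_of_pos hr] using hrs
      simp [M, hrs, this]
  -- The identity `key` holds only for `s > 0`, which suffices near `t > 0`.
  refine (hM.integral_hasStrictDerivAt 0 t).hasDerivAt.congr_of_eventuallyEq ?_
  filter_upwards [lt_mem_nhds ht] with s hs using key s hs

/-- Replacing `G` by its mean over spheres centred at the origin amounts, when integrating against
a kernel depending on the distance to `w`, to averaging over the sphere through `w`. -/
theorem integral_sphericalMean_mul [Nontrivial E] {G : E → ℝ} (hG : Continuous G)
    (hGs : HasCompactSupport G) {k : ℝ → ℝ} (hk : Continuous k) (w : E) :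
    ∫ z : E, (∫ θ : sphere (0 : E) 1, G (‖z‖ • (θ : E)) ∂(volume : Measure E).toSphere) *
        k ‖w - z‖ =
      ∫ η : sphere (0 : E) 1, (∫ z : E, G z * k ‖‖w‖ • (η : E) - z‖)
        ∂(volume : Measure E).toSphere := by
  set σ := (volume : Measure E).toSphere
  let A : E → ℝ := fun z => ∫ θ : sphere (0 : E) 1, G (‖z‖ • (θ : E)) ∂σ
  let κ : E → ℝ := fun z => ∫ η : sphere (0 : E) 1, k ‖‖w‖ • (η : E) - z‖ ∂σ
  have hA : Continuous A :=
    continuous_integral_sphere (F := fun (z x : E) => G (‖z‖ • x)) (by fun_prop)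
  have hκ : Continuous κ :=
    continuous_integral_sphere (F := fun (z x : E) => k ‖‖w‖ • x - z‖) (by fun_prop)
  have hAs : HasCompactSupport A := by
    obtain ⟨ρ, hρ⟩ := hGs.isCompact.isBounded.subset_closedBall 0
    refine HasCompactSupport.intro (isCompact_closedBall (0 : E) ρ) fun z hz => ?_
    refine integral_eq_zero_of_ae (.of_forall fun θ => ?_)
    by_contra hne
    have := hρ (subset_tsupport _ hne)
    apply hz
    simpa [norm_smul] using this
  have hAk : Integrable fun z => A z * k ‖w - z‖ :=
    (hA.mul (by fun_prop)).integrable_of_hasCompactSupport hAs.mul_right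
  have hGκ : Integrable fun z => G z * κ z :=
    (hG.mul hκ).integrable_of_hasCompactSupport hGs.mul_right
  have hswap : ∫ η : sphere (0 : E) 1, (∫ z : E, G z * k ‖‖w‖ • (η : E) - z‖) ∂σ =
      ∫ z, G z * κ z := by
    rw [integral_integral_swap_of_hasCompactSupport]
    · simp only [κ, integral_const_mul]
    · simp only [Function.uncurry_def]
      fun_prop
    · refine HasCompactSupport.intro (isCompact_univ.prod hGs.isCompact) fun p hp => ?_
      have : p.2 ∉ tsupport G := fun h => hp ⟨mem_univ _, h⟩
      simp [Function.uncurry, image_eq_zero_of_notMem_tsupport this]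
  rw [hswap]
  change ∫ z, A z * k ‖w - z‖ = _
  -- On the sphere of radius `r` both `A` and `κ` are constant, so each side reduces to the same
  -- product of two spherical integrals, of `G` and of the kernel.
  rw [integral_polar hAk, integral_polar hGκ]
  refine setIntegral_congr_fun measurableSet_Ioi fun r hr => ?_
  have hr : 0 < r := hr
  have hAr : ∀ θ : sphere (0 : E) 1,
      A (r • (θ : E)) = ∫ θ : sphere (0 : E) 1, G (r • (θ : E)) ∂σ := fun θ => by
    simp [A, norm_smul, abs_of_pos hr]
  have hκr : ∀ θ : sphere (0 : E) 1,
      κ (r • (θ : E)) = ∫ η : sphere (0 : E) 1, k ‖w - r • (η : E)‖ ∂σ := fun θ => by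
    have h1 : ‖‖w‖ • (θ : E)‖ = ‖w‖ := by simp [norm_smul]
    rw [← integral_sphere_norm_sub_eq k r h1]
    refine integral_congr_ae (.of_forall fun η => ?_)
    simp only
    -- For unit vectors, exchanging the radii `‖w‖` and `r` between `η` and `θ` leaves the distance
    -- unchanged.
    rw [norm_smul_sub_smul_comm (a := (η : E)) (b := θ) (by simp), norm_sub_rev]
  simp only [hAr, hκr, integral_const_mul, integral_mul_const]
  rfl

end Sphere

/-! ### Affine coordinates turning ellipsoids into balls. -/

section Parametrization

open Metric

variable {m : ℕ}

/-- The inclusion `u ↦ (u, 0)` of `ℝⁿ⁻¹` into `ℝⁿ`. -/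
noncomputable def inclusion (u : EuclideanSpace ℝ (Fin m)) : EuclideanSpace ℝ (Fin (m + 1)) :=
  WithLp.toLp 2 (Fin.snoc (α := fun _ => ℝ) u.ofLp 0)

@[simp]
theorem inclusion_castSucc (u : EuclideanSpace ℝ (Fin m)) (i : Fin m) :
    inclusion u i.castSucc = u i := by
  simp [inclusion]

@[simp]
theorem inclusion_last (u : EuclideanSpace ℝ (Fin m)) : inclusion u (Fin.last m) = 0 := by
  simp [inclusion]

theorem continuous_inclusion :
    Continuous (inclusion : EuclideanSpace ℝ (Fin m) → EuclideanSpace ℝ (Fin (m + 1))) := by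
  refine (PiLp.continuous_toLp 2 _).comp (continuous_pi fun i => ?_)
  refine Fin.lastCases ?_ (fun j => ?_) i
  · simpa using continuous_const
  · simp only [Fin.snoc_castSucc]
    fun_prop

theorem inclusion_sub (u v : EuclideanSpace ℝ (Fin m)) :
    inclusion (u - v) = inclusion u - inclusion v := by
  ext i
  refine Fin.lastCases ?_ (fun j => ?_) i <;> simp

/-- The linear map which scales the `i`-th coordinate by `axisScale lam i`. -/
noncomputable def axisMap (m : ℕ) (lam : ℝ) :
    EuclideanSpace ℝ (Fin (m + 1)) →ₗ[ℝ] EuclideanSpace ℝ (Fin (m + 1)) :=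
  (WithLp.linearEquiv 2 ℝ (Fin (m + 1) → ℝ)).symm.conj
    (Matrix.toLin' (Matrix.diagonal fun i : Fin (m + 1) => axisScale lam i))

@[simp]
theorem axisMap_apply (lam : ℝ) (z : EuclideanSpace ℝ (Fin (m + 1))) (i : Fin (m + 1)) :
    axisMap m lam z i = axisScale lam i * z i := by
  simp [axisMap, LinearEquiv.conj_apply, Matrix.mulVec_diagonal]

theorem nu_pos {lam : ℝ} (hlam : 1 < lam) : 0 < nu lam :=
  Real.sqrt_pos.2 (by nlinarith)

theorem axisScale_pos {lam : ℝ} (hlam : 1 < lam) (i : ℕ) : 0 < axisScale lam i := by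
  unfold axisScale
  split_ifs
  · linarith
  · exact nu_pos hlam

theorem jacobian_pos {lam : ℝ} (m : ℕ) (hlam : 1 < lam) : 0 < jacobian m lam :=
  mul_pos (by linarith) (pow_pos (nu_pos hlam) m)

theorem det_axisMap (m : ℕ) (lam : ℝ) : LinearMap.det (axisMap m lam) = jacobian m lam := by
  rw [axisMap, LinearEquiv.conj_apply, LinearMap.comp_assoc, LinearMap.det_conj,
    LinearMap.det_toLin', Matrix.det_diagonal, Fin.prod_univ_succ]
  simp [axisScale, jacobian]

theorem continuous_axisMap (m : ℕ) (lam : ℝ) : Continuous (axisMap m lam) :=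
  (axisMap m lam).continuous_of_finiteDimensional

/-- The affine coordinates on `ℝⁿ` in which the solid ellipsoids with centre `(u, 0)` are balls. -/
noncomputable def ellipsoidPoint (lam : ℝ) (u : EuclideanSpace ℝ (Fin m))
    (z : EuclideanSpace ℝ (Fin (m + 1))) : EuclideanSpace ℝ (Fin (m + 1)) :=
  inclusion u + axisMap m lam z

/-- The inverse of `ellipsoidPoint`. -/
noncomputable def ellipsoidCoord (lam : ℝ) (u : EuclideanSpace ℝ (Fin m))
    (x : EuclideanSpace ℝ (Fin (m + 1))) : EuclideanSpace ℝ (Fin (m + 1)) :=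
  WithLp.toLp 2 fun i => (x i - inclusion u i) / axisScale lam i

theorem ellipsoidCoord_ellipsoidPoint {lam : ℝ} (hlam : 1 < lam) (u : EuclideanSpace ℝ (Fin m))
    (z : EuclideanSpace ℝ (Fin (m + 1))) :
    ellipsoidCoord lam u (ellipsoidPoint lam u z) = z := by
  ext i
  simp [ellipsoidCoord, ellipsoidPoint, (axisScale_pos hlam i).ne']

theorem continuous_ellipsoidPoint (lam : ℝ) :
    Continuous fun p : EuclideanSpace ℝ (Fin m) × EuclideanSpace ℝ (Fin (m + 1)) =>
      ellipsoidPoint lam p.1 p.2 :=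
  (continuous_inclusion.comp continuous_fst).add ((continuous_axisMap m lam).comp continuous_snd)

theorem continuous_ellipsoidCoord (lam : ℝ) :
    Continuous fun p : EuclideanSpace ℝ (Fin m) × EuclideanSpace ℝ (Fin (m + 1)) =>
      ellipsoidCoord lam p.1 p.2 := by
  refine (PiLp.continuous_toLp 2 _).comp (continuous_pi fun i => ?_)
  have := continuous_inclusion (m := m)
  fun_prop

theorem ellipsoidPoint_sub_ellipsoidPoint (lam : ℝ) (u u' : EuclideanSpace ℝ (Fin m))
    (w z : EuclideanSpace ℝ (Fin (m + 1))) :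
    ellipsoidPoint lam u w - ellipsoidPoint lam (u - u') z = ellipsoidPoint lam u' (w - z) := by
  simp only [ellipsoidPoint, inclusion_sub, map_sub]
  abel

theorem quadForm_ellipsoidPoint (hm : 1 ≤ m) {lam : ℝ} (hlam : 1 < lam)
    (u : EuclideanSpace ℝ (Fin m)) (z : EuclideanSpace ℝ (Fin (m + 1))) :
    quadForm lam u (ellipsoidPoint lam u z) = ‖z‖ ^ 2 := by
  -- Here `1 ≤ m` matters: for `m = 0` the last axis would also be the first and have scale `λ`.
  have hlast : axisScale lam m = nu lam := by simp [axisScale, Nat.one_le_iff_ne_zero.1 hm]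
  rw [EuclideanSpace.norm_sq_eq, Fin.sum_univ_castSucc, quadForm]
  congr 1
  · refine Finset.sum_congr rfl fun i _ => ?_
    have := (axisScale_pos hlam i).ne'
    simp [ellipsoidPoint, mul_pow]
    field_simp
  · have := (nu_pos hlam).ne'
    simp [ellipsoidPoint, mul_pow, hlast]
    field_simp

@[fun_prop]
theorem continuous_quadForm {X : Type*} [TopologicalSpace X] (lam : ℝ)
    {a : X → EuclideanSpace ℝ (Fin m)} {b : X → EuclideanSpace ℝ (Fin (m + 1))}
    (ha : Continuous a) (hb : Continuous b) : Continuous fun p => quadForm lam (a p) (b p) := by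
  unfold quadForm
  simp only [div_eq_mul_inv]
  fun_prop

/-- No integrability is required: an invertible linear map rescales Lebesgue measure by a constant,
and translation preserves it. -/
theorem integral_comp_ellipsoidPoint {lam : ℝ} (hlam : 1 < lam) (u : EuclideanSpace ℝ (Fin m))
    (h : EuclideanSpace ℝ (Fin (m + 1)) → ℝ) :
    ∫ x, h x = jacobian m lam * ∫ z, h (ellipsoidPoint lam u z) := by
  have hC := jacobian_pos m hlam
  have hdet : LinearMap.det (axisMap m lam) ≠ 0 := by rw [det_axisMap]; exact hC.ne'
  have hemb : MeasurableEmbedding (axisMap m lam) :=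
    ((LinearMap.equivOfDetNeZero _ hdet).toContinuousLinearEquiv.toHomeomorph).measurableEmbedding
  have h1 : ∫ z, h (ellipsoidPoint lam u z) =
      ∫ x, h (inclusion u + x) ∂(Measure.map (axisMap m lam) volume) :=
    (hemb.integral_map fun x => h (inclusion u + x)).symm
  rw [h1, Measure.map_linearMap_addHaar_eq_smul_addHaar _ hdet, integral_smul_measure,
    integral_add_left_eq_self, det_axisMap, abs_of_pos (inv_pos.2 hC),
    ENNReal.toReal_ofReal (inv_pos.2 hC).le, smul_eq_mul, mul_inv_cancel_left₀ hC.ne']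

theorem radonE_eq (hm : 1 ≤ m) {lam : ℝ} (hlam : 1 < lam)
    (h : EuclideanSpace ℝ (Fin (m + 1)) → ℝ) (u : EuclideanSpace ℝ (Fin m)) {s : ℝ}
    (hs : 0 ≤ s) :
    radonE lam h (u, s) =
      jacobian m lam * ∫ z in closedBall 0 s, h (ellipsoidPoint lam u z) := by
  have hmeas : MeasurableSet (solidEllipsoid lam u s) :=
    measurableSet_le (continuous_quadForm lam continuous_const continuous_id).measurable
      measurable_const
  rw [radonE, ← integral_indicator hmeas, integral_comp_ellipsoidPoint hlam u,
    ← integral_indicator measurableSet_closedBall]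
  congr 2 with z
  have : ellipsoidPoint lam u z ∈ solidEllipsoid lam u s ↔ z ∈ closedBall 0 s := by
    rw [solidEllipsoid, mem_ofPred_eq, quadForm_ellipsoidPoint hm hlam, mem_closedBall_zero_iff,
      sq_le_sq₀ (norm_nonneg _) hs]
  by_cases hz : z ∈ closedBall 0 s
  · rw [indicator_of_mem hz, indicator_of_mem (this.2 hz)]
  · rw [indicator_of_notMem hz, indicator_of_notMem (mt this.1 hz)]

/-- The integral of `h` over the boundary of the solid ellipsoid `E_{u,t}`, with respect to the
surface measure of the unit sphere. -/
noncomputable def ellipsoidalIntegral (lam : ℝ) (h : EuclideanSpace ℝ (Fin (m + 1)) → ℝ)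
    (u : EuclideanSpace ℝ (Fin m)) (t : ℝ) : ℝ :=
  ∫ θ : sphere (0 : EuclideanSpace ℝ (Fin (m + 1))) 1,
    h (ellipsoidPoint lam u (t • (θ : EuclideanSpace ℝ (Fin (m + 1)))))
    ∂(volume : Measure (EuclideanSpace ℝ (Fin (m + 1)))).toSphere

theorem hasDerivAt_radonE (hm : 1 ≤ m) {lam : ℝ} (hlam : 1 < lam)
    {h : EuclideanSpace ℝ (Fin (m + 1)) → ℝ} (hc : Continuous h) (u : EuclideanSpace ℝ (Fin m))
    {t : ℝ} (ht : 0 < t) :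
    HasDerivAt (fun s => radonE lam h (u, s))
      (jacobian m lam * (t ^ m * ellipsoidalIntegral lam h u t)) t := by
  have hcu : Continuous fun z => h (ellipsoidPoint lam u z) :=
    hc.comp ((continuous_ellipsoidPoint lam).comp (Continuous.prodMk_right u))
  have hd := (hasDerivAt_integral_closedBall hcu ht).const_mul (jacobian m lam)
  rw [finrank_euclideanSpace_fin, Nat.add_sub_cancel] at hd
  refine hd.congr_of_eventuallyEq ?_
  filter_upwards [lt_mem_nhds ht] with s hs using radonE_eq hm hlam h u hs.le

theorem partialT_radonE (hm : 1 ≤ m) {lam : ℝ} (hlam : 1 < lam)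
    {h : EuclideanSpace ℝ (Fin (m + 1)) → ℝ} (hc : Continuous h) (u : EuclideanSpace ℝ (Fin m))
    {t : ℝ} (ht : 0 < t) :
    partialT (radonE lam h) (u, t) =
      jacobian m lam * (t ^ m * ellipsoidalIntegral lam h u t) :=
  (hasDerivAt_radonE hm hlam hc u ht).deriv

theorem radonData_eq (hm : 1 ≤ m) {lam : ℝ} (hlam : 1 < lam)
    {h : EuclideanSpace ℝ (Fin (m + 1)) → ℝ} (hc : Continuous h) (u : EuclideanSpace ℝ (Fin m))
    {t : ℝ} (ht : 0 < t) :
    radonData lam h (u, t) = jacobian m lam * ellipsoidalIntegral lam h u t := by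
  have := (pow_pos ht m).ne'
  rw [radonData, partialT_radonE hm hlam hc u ht]
  field_simp

end Parametrization

/-! ### The back projection, the two convolutions and their comparison. -/

section Convolution

open Metric

variable {m : ℕ}

theorem notMem_image_fst_tsupport {X Y : Type*} [TopologicalSpace X] [TopologicalSpace Y]
    {φ : X × Y → ℝ} {x : X} (hx : x ∉ Prod.fst '' tsupport φ) (y : Y) : φ (x, y) = 0 :=
  image_eq_zero_of_notMem_tsupport fun h => hx ⟨_, h, rfl⟩

theorem integrable_backProj {lam : ℝ} {φ : EuclideanSpace ℝ (Fin m) × ℝ → ℝ}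
    (hφ : Continuous φ) (hφs : HasCompactSupport φ) (x : EuclideanSpace ℝ (Fin (m + 1))) :
    Integrable fun u => φ (u, Real.sqrt (quadForm lam u x)) := by
  have hq : Continuous fun u : EuclideanSpace ℝ (Fin m) => quadForm lam u x :=
    continuous_quadForm lam continuous_id continuous_const
  refine Continuous.integrable_of_hasCompactSupport (by fun_prop) ?_
  exact HasCompactSupport.intro (hφs.isCompact.image continuous_fst) fun u hu =>
    notMem_image_fst_tsupport (φ := φ) hu _

theorem continuous_backProj {lam : ℝ} {φ : EuclideanSpace ℝ (Fin m) × ℝ → ℝ}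
    (hφ : Continuous φ) (hφs : HasCompactSupport φ) :
    Continuous (backProj (m := m) lam φ) := by
  have hK : IsCompact (Prod.fst '' tsupport φ) := hφs.isCompact.image continuous_fst
  have h := continuous_parametric_integral_of_continuous
    (μ := (volume : Measure (EuclideanSpace ℝ (Fin m))))
    (f := fun (x : EuclideanSpace ℝ (Fin (m + 1))) u => φ (u, Real.sqrt (quadForm lam u x)))
    (hφ.comp (continuous_snd.prodMk
      (continuous_quadForm lam continuous_snd continuous_fst).sqrt)) hK
  convert h using 2 with x
  exact (setIntegral_eq_integral_of_forall_compl_eq_zero fun u hu =>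
    notMem_image_fst_tsupport (φ := φ) hu _).symm

/-- For centres in a compact set, the ellipsoidal coordinates of a compactly supported function
stay bounded. -/
theorem exists_norm_le_of_ne_zero {lam : ℝ} (hlam : 1 < lam)
    {f : EuclideanSpace ℝ (Fin (m + 1)) → ℝ} (hfs : HasCompactSupport f)
    {K : Set (EuclideanSpace ℝ (Fin m))} (hK : IsCompact K) (u : EuclideanSpace ℝ (Fin m)) :
    ∃ ρ : ℝ, ∀ u' ∈ K, ∀ z, f (ellipsoidPoint lam (u - u') z) ≠ 0 → ‖z‖ ≤ ρ := by
  have hcont : Continuous fun p : EuclideanSpace ℝ (Fin m) × EuclideanSpace ℝ (Fin (m + 1)) =>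
      ellipsoidCoord lam (u - p.1) p.2 :=
    (continuous_ellipsoidCoord lam).comp
      ((continuous_const.sub continuous_fst).prodMk continuous_snd)
  obtain ⟨ρ, hρ⟩ := ((hK.prod hfs.isCompact).image hcont).isBounded.subset_closedBall 0
  refine ⟨ρ, fun u' hu' z hz => ?_⟩
  rw [← mem_closedBall_zero_iff]
  exact hρ ⟨(u', ellipsoidPoint lam (u - u') z), ⟨hu', subset_tsupport _ hz⟩,
    ellipsoidCoord_ellipsoidPoint hlam _ _⟩

/-- After Fubini, the inner integral over `y` is taken in the coordinates centred at `u - u'`. Then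
`q(u', x - y) = |w - z|²`, so the back projection kernel becomes radial in `w - z`. -/
theorem conv_ellipsoidPoint (hm : 1 ≤ m) {lam : ℝ} (hlam : 1 < lam)
    {f : EuclideanSpace ℝ (Fin (m + 1)) → ℝ} (hf : Continuous f) (hfs : HasCompactSupport f)
    {φ : EuclideanSpace ℝ (Fin m) × ℝ → ℝ} (hφ : Continuous φ) (hφs : HasCompactSupport φ)
    (u : EuclideanSpace ℝ (Fin m)) (w : EuclideanSpace ℝ (Fin (m + 1))) :
    conv f (backProj lam φ) (ellipsoidPoint lam u w) =
      jacobian m lam * ∫ u', ∫ z, f (ellipsoidPoint lam (u - u') z) * φ (u', ‖w - z‖) := by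
  have h1 : conv f (backProj lam φ) (ellipsoidPoint lam u w) =
      ∫ y, ∫ u', f y * φ (u', Real.sqrt (quadForm lam u' (ellipsoidPoint lam u w - y))) := by
    simp only [integral_const_mul]
    rfl
  rw [h1, integral_integral_swap_of_hasCompactSupport, ← integral_const_mul]
  · congr 1 with u'
    rw [integral_comp_ellipsoidPoint hlam (u - u')]
    simp only [ellipsoidPoint_sub_ellipsoidPoint, quadForm_ellipsoidPoint hm hlam,
      Real.sqrt_sq (norm_nonneg _)]
  · have : Continuous fun p : EuclideanSpace ℝ (Fin (m + 1)) × EuclideanSpace ℝ (Fin m) =>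
        quadForm lam p.2 (ellipsoidPoint lam u w - p.1) :=
      continuous_quadForm lam continuous_snd (continuous_const.sub continuous_fst)
    simp only [Function.uncurry_def]
    fun_prop
  · refine HasCompactSupport.intro (hfs.isCompact.prod (hφs.isCompact.image continuous_fst))
      fun p hp => ?_
    simp only [Function.uncurry_def]
    by_cases h : p.1 ∈ tsupport f
    · rw [notMem_image_fst_tsupport (φ := φ) (fun h' => hp ⟨h, h'⟩), mul_zero]
    · rw [image_eq_zero_of_notMem_tsupport h, zero_mul]

theorem continuous_ellipsoidalIntegral {lam : ℝ} {f : EuclideanSpace ℝ (Fin (m + 1)) → ℝ}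
    (hf : Continuous f) :
    Continuous fun p : EuclideanSpace ℝ (Fin m) × ℝ => ellipsoidalIntegral lam f p.1 p.2 := by
  have hP := continuous_ellipsoidPoint (m := m) lam
  refine continuous_integral_sphere
    (F := fun (p : EuclideanSpace ℝ (Fin m) × ℝ) x => f (ellipsoidPoint lam p.1 (p.2 • x))) ?_
  exact hf.comp (hP.comp ((continuous_fst.comp continuous_fst).prodMk
    ((continuous_snd.comp continuous_fst).smul continuous_snd)))

theorem continuous_ellipsoidalIntegral_mul {lam : ℝ} {f : EuclideanSpace ℝ (Fin (m + 1)) → ℝ}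
    (hf : Continuous f) {φ : EuclideanSpace ℝ (Fin m) × ℝ → ℝ} (hφ : Continuous φ)
    (u : EuclideanSpace ℝ (Fin m)) (w : EuclideanSpace ℝ (Fin (m + 1))) :
    Continuous fun q : EuclideanSpace ℝ (Fin (m + 1)) × EuclideanSpace ℝ (Fin m) =>
      ellipsoidalIntegral lam f (u - q.2) ‖w - q.1‖ * φ (q.2, ‖q.1‖) := by
  have h := (continuous_ellipsoidalIntegral (lam := lam) hf).comp
    (f := fun q : EuclideanSpace ℝ (Fin (m + 1)) × EuclideanSpace ℝ (Fin m) =>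
      (u - q.2, ‖w - q.1‖)) (by fun_prop)
  exact h.mul (by fun_prop)

theorem hasCompactSupport_mul_radial {φ : EuclideanSpace ℝ (Fin m) × ℝ → ℝ}
    (hφs : HasCompactSupport φ)
    (a : EuclideanSpace ℝ (Fin (m + 1)) × EuclideanSpace ℝ (Fin m) → ℝ) :
    HasCompactSupport fun q : EuclideanSpace ℝ (Fin (m + 1)) × EuclideanSpace ℝ (Fin m) =>
      a q * φ (q.2, ‖q.1‖) := by
  obtain ⟨ρ, hρ⟩ :=
    (hφs.isCompact.image continuous_snd).isBounded.subset_closedBall (0 : ℝ)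
  refine HasCompactSupport.intro ((isCompact_closedBall (0 : EuclideanSpace ℝ (Fin (m + 1))) ρ).prod
    (hφs.isCompact.image continuous_fst)) fun q hq => ?_
  by_contra hne
  have hmem : (q.2, ‖q.1‖) ∈ tsupport φ := subset_tsupport _ (right_ne_zero_of_mul hne)
  refine hq ⟨?_, _, hmem, rfl⟩
  simpa using hρ ⟨_, hmem, rfl⟩

/-- The diagonal `w' = w` is excluded because there `radonData` is evaluated at `t = 0`, where `1 /
0 ^ m` has the default value `0`. It is a null set, so the integrals are unaffected. -/
theorem radialConvKernel_radonData_of_ne (hm : 1 ≤ m) {lam : ℝ} (hlam : 1 < lam)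
    {f : EuclideanSpace ℝ (Fin (m + 1)) → ℝ} (hf : Continuous f)
    (φ : EuclideanSpace ℝ (Fin m) × ℝ → ℝ)
    (u : EuclideanSpace ℝ (Fin m)) {w w' : EuclideanSpace ℝ (Fin (m + 1))} (hw : w' ≠ w)
    (u' : EuclideanSpace ℝ (Fin m)) :
    radialConvKernel (radonData lam f) φ u w w' u' = jacobian m lam *
      (ellipsoidalIntegral lam f (u - u') ‖w - w'‖ * φ (u', ‖w'‖)) := by
  rw [radialConvKernel, radonData_eq hm hlam hf _ (norm_pos_iff.2 (sub_ne_zero.2 hw.symm)),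
    mul_assoc]

theorem integrable_radialConvKernel (hm : 1 ≤ m) {lam : ℝ} (hlam : 1 < lam)
    {f : EuclideanSpace ℝ (Fin (m + 1)) → ℝ} (hf : Continuous f)
    {φ : EuclideanSpace ℝ (Fin m) × ℝ → ℝ} (hφ : Continuous φ) (hφs : HasCompactSupport φ)
    (u : EuclideanSpace ℝ (Fin m)) (w : EuclideanSpace ℝ (Fin (m + 1))) :
    Integrable (fun q : EuclideanSpace ℝ (Fin (m + 1)) × EuclideanSpace ℝ (Fin m) =>
      radialConvKernel (radonData lam f) φ u w q.1 q.2) (volume.prod volume) := by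
  have hB := ((continuous_ellipsoidalIntegral_mul (lam := lam) hf hφ u
    w).integrable_of_hasCompactSupport (μ := volume.prod volume)
      (hasCompactSupport_mul_radial hφs _)).const_mul (jacobian m lam)
  refine hB.congr ?_
  have hae : ∀ᵐ x : EuclideanSpace ℝ (Fin (m + 1)), x ≠ w := Measure.ae_ne volume w
  filter_upwards [Measure.quasiMeasurePreserving_fst.ae hae] with q hq
  exact (radialConvKernel_radonData_of_ne hm hlam hf φ u hq q.2).symm

theorem radialConv_eq (hm : 1 ≤ m) {lam : ℝ} (hlam : 1 < lam)
    {f : EuclideanSpace ℝ (Fin (m + 1)) → ℝ} (hf : Continuous f) (hfs : HasCompactSupport f)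
    {φ : EuclideanSpace ℝ (Fin m) × ℝ → ℝ} (hφ : Continuous φ) (hφs : HasCompactSupport φ)
    (u : EuclideanSpace ℝ (Fin m)) (w : EuclideanSpace ℝ (Fin (m + 1))) :
    radialConv (radonData lam f) φ u w =
      ellipsoidalIntegral lam (conv f (backProj lam φ)) u ‖w‖ := by
  set K : Set (EuclideanSpace ℝ (Fin m)) := Prod.fst '' tsupport φ
  have hK : IsCompact K := hφs.isCompact.image continuous_fst
  have hP := continuous_ellipsoidPoint (m := m) lam
  obtain ⟨ρ, hρ⟩ := exists_norm_le_of_ne_zero hlam hfs hK u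
  have h1 : radialConv (radonData lam f) φ u w = jacobian m lam *
      ∫ w', ∫ u', ellipsoidalIntegral lam f (u - u') ‖w - w'‖ * φ (u', ‖w'‖) := by
    rw [radialConv, ← integral_const_mul]
    have hae : ∀ᵐ x : EuclideanSpace ℝ (Fin (m + 1)), x ≠ w := Measure.ae_ne volume w
    refine integral_congr_ae ?_
    filter_upwards [hae] with w' hw'
    rw [← integral_const_mul]
    congr 1 with u'
    exact radialConvKernel_radonData_of_ne hm hlam hf φ u hw' u'
  have h2 : ∀ u', ∫ w', ellipsoidalIntegral lam f (u - u') ‖w - w'‖ * φ (u', ‖w'‖) =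
      ∫ η : sphere (0 : EuclideanSpace ℝ (Fin (m + 1))) 1,
        (∫ z, f (ellipsoidPoint lam (u - u') z) *
          φ (u', ‖‖w‖ • (η : EuclideanSpace ℝ (Fin (m + 1))) - z‖))
        ∂(volume : Measure (EuclideanSpace ℝ (Fin (m + 1)))).toSphere := by
    intro u'
    -- For `u' ∈ K` the radius `ρ` bounds the support in `z`, and `w' ↦ w - w'` reduces the claim to
    -- the exchange of spherical means. For other `u'` both sides vanish.
    by_cases hu' : u' ∈ K
    · rw [← integral_sub_left_eq_self _ volume w]
      simp only [sub_sub_cancel]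
      have hG : Continuous fun z => f (ellipsoidPoint lam (u - u') z) :=
        hf.comp (hP.comp (Continuous.prodMk_right (u - u')))
      have hGs : HasCompactSupport fun z => f (ellipsoidPoint lam (u - u') z) :=
        HasCompactSupport.intro (isCompact_closedBall 0 ρ) fun z hz => by
          by_contra hne
          exact hz (mem_closedBall_zero_iff.2 (hρ u' hu' z hne))
      exact integral_sphericalMean_mul hG hGs (k := fun r => φ (u', r)) (by fun_prop) w
    · simp [notMem_image_fst_tsupport (φ := φ) hu']
  have hJ : Continuous (Function.uncurry
      fun (u' : EuclideanSpace ℝ (Fin m)) (η : sphere (0 : EuclideanSpace ℝ (Fin (m + 1))) 1) =>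
        ∫ z, f (ellipsoidPoint lam (u - u') z) *
          φ (u', ‖‖w‖ • (η : EuclideanSpace ℝ (Fin (m + 1))) - z‖)) := by
    have h := continuous_parametric_integral_of_continuous
      (μ := (volume : Measure (EuclideanSpace ℝ (Fin (m + 1)))))
      (f := fun (p : EuclideanSpace ℝ (Fin m) × sphere (0 : EuclideanSpace ℝ (Fin (m + 1))) 1) z =>
        f (ellipsoidPoint lam (u - p.1) z) *
          φ (p.1, ‖‖w‖ • (p.2 : EuclideanSpace ℝ (Fin (m + 1))) - z‖)) ?_
      (isCompact_closedBall 0 ρ)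
    · convert h using 2 with p
      refine (setIntegral_eq_integral_of_forall_compl_eq_zero fun z hz => ?_).symm
      by_contra hne
      -- A nonzero factor `φ` forces `p.1 ∈ K`, so the single radius `ρ` serves all `u'`.
      refine hz (mem_closedBall_zero_iff.2 (hρ p.1 ?_ z (left_ne_zero_of_mul hne)))
      exact ⟨_, subset_tsupport _ (right_ne_zero_of_mul hne), rfl⟩
    · refine (hf.comp (hP.comp (g := fun q : EuclideanSpace ℝ (Fin m) ×
        EuclideanSpace ℝ (Fin (m + 1)) => ellipsoidPoint lam q.1 q.2)
        (f := fun q : (EuclideanSpace ℝ (Fin m) ×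
        sphere (0 : EuclideanSpace ℝ (Fin (m + 1))) 1) × EuclideanSpace ℝ (Fin (m + 1)) =>
        (u - q.1.1, q.2)) (by fun_prop))).mul ?_
      fun_prop
  rw [h1, integral_integral_swap_of_hasCompactSupport]
  · simp only [h2]
    rw [integral_integral_swap_of_hasCompactSupport hJ, ← integral_const_mul]
    · simp only [ellipsoidalIntegral, conv_ellipsoidPoint hm hlam hf hfs hφ hφs]
    · refine HasCompactSupport.intro (hK.prod isCompact_univ) fun p hp => ?_
      have hp1 : p.1 ∉ K := fun h => hp ⟨h, mem_univ _⟩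
      simp [Function.uncurry_def, notMem_image_fst_tsupport (φ := φ) hp1]
  · exact continuous_ellipsoidalIntegral_mul hf hφ u w
  · exact hasCompactSupport_mul_radial hφs fun q => ellipsoidalIntegral lam f (u - q.2) ‖w - q.1‖

theorem continuous_conv_backProj {lam : ℝ} {f : EuclideanSpace ℝ (Fin (m + 1)) → ℝ}
    (hf : Continuous f) (hfs : HasCompactSupport f)
    {φ : EuclideanSpace ℝ (Fin m) × ℝ → ℝ} (hφ : Continuous φ) (hφs : HasCompactSupport φ) :
    Continuous (conv f (backProj lam φ)) :=
  hfs.continuous_convolution_left _ hf (continuous_backProj hφ hφs).locallyIntegrable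

/-- The even extension of a test function on the closed half space. -/
def evenExtension (φ : EuclideanSpace ℝ (Fin m) × ℝ → ℝ) (p : EuclideanSpace ℝ (Fin m) × ℝ) : ℝ :=
  φ (p.1, |p.2|)

theorem evenExtension_of_nonneg (φ : EuclideanSpace ℝ (Fin m) × ℝ → ℝ)
    (u : EuclideanSpace ℝ (Fin m)) {r : ℝ} (hr : 0 ≤ r) : evenExtension φ (u, r) = φ (u, r) := by
  simp [evenExtension, abs_of_nonneg hr]

/-- The values of `φ` at `t < 0` are arbitrary; the extension replaces `φ` by a function continuous
on the whole space. -/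
theorem IsTestFunctionOnHalfSpace.continuous_evenExtension
    {φ : EuclideanSpace ℝ (Fin m) × ℝ → ℝ} (hφ : IsTestFunctionOnHalfSpace φ) :
    Continuous (evenExtension φ) :=
  hφ.1.continuousOn.comp_continuous (by fun_prop) fun p => ⟨mem_univ _, abs_nonneg p.2⟩

theorem IsTestFunctionOnHalfSpace.hasCompactSupport_evenExtension
    {φ : EuclideanSpace ℝ (Fin m) × ℝ → ℝ} (hφ : IsTestFunctionOnHalfSpace φ) :
    HasCompactSupport (evenExtension φ) := by
  obtain ⟨-, K, hK, hzero⟩ := hφ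
  refine HasCompactSupport.intro (K := K ∪ (fun p => (p.1, -p.2)) '' K)
    (hK.union (hK.image (by fun_prop))) fun p hp => ?_
  refine hzero _ ⟨mem_univ _, abs_nonneg p.2⟩ fun hmem => hp ?_
  rcases abs_choice p.2 with h | h
  · exact Or.inl (by rwa [h] at hmem)
  · exact Or.inr ⟨_, hmem, by simp [h]⟩

end Convolution

end EllipticalRadon

/-! ### Assembly of the main theorem. -/

theorem mainTheorem2 (m : ℕ) (hm : 1 ≤ m) (lam : ℝ) (hlam : 1 < lam)
    (φ : EuclideanSpace ℝ (Fin m) × ℝ → ℝ)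
    (hφ : EllipticalRadon.IsTestFunctionOnHalfSpace φ)
    (f : EuclideanSpace ℝ (Fin (m + 1)) → ℝ)
    (hf_smooth : ContDiff ℝ ∞ f) (hf_supp : HasCompactSupport f)
    (hf_even : EllipticalRadon.IsEvenInLast f)
    (ψ : EuclideanSpace ℝ (Fin (m + 1)) → ℝ) (hψ : ψ = EllipticalRadon.backProj lam φ)
    (g : EuclideanSpace ℝ (Fin m) × ℝ → ℝ) (hg : g = EllipticalRadon.radonData lam f) :
    -- the objects in the formula are well defined: `ψ`, `f * ψ`, `R_E (f * ψ)`, `∂_t R_E`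
    (∀ x : EuclideanSpace ℝ (Fin (m + 1)),
      Integrable (fun u : EuclideanSpace ℝ (Fin m) =>
        φ (u, Real.sqrt (EllipticalRadon.quadForm lam u x))) volume) ∧
    ConvolutionExists f ψ (ContinuousLinearMap.mul ℝ ℝ) volume ∧
    LocallyIntegrable (EllipticalRadon.conv f ψ) volume ∧
    (∀ (u : EuclideanSpace ℝ (Fin m)) (t : ℝ), 0 < t →
      DifferentiableAt ℝ (fun s : ℝ => EllipticalRadon.radonE lam f (u, s)) t ∧
      DifferentiableAt ℝ
        (fun s : ℝ => EllipticalRadon.radonE lam (EllipticalRadon.conv f ψ) (u, s)) t) ∧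
    -- the double integral for `g * φ` converges absolutely, and the formula holds at `t = |ω| > 0`
    (∀ (u : EuclideanSpace ℝ (Fin m)) (w : EuclideanSpace ℝ (Fin (m + 1))), w ≠ 0 →
      Integrable (fun q : EuclideanSpace ℝ (Fin (m + 1)) × EuclideanSpace ℝ (Fin m) =>
        EllipticalRadon.radialConvKernel g φ u w q.1 q.2) (volume.prod volume) ∧
      EllipticalRadon.radialConv g φ u w =
        1 / (EllipticalRadon.jacobian m lam * ‖w‖ ^ m) *
          EllipticalRadon.partialT
            (EllipticalRadon.radonE lam (EllipticalRadon.conv f ψ)) (u, ‖w‖)) := by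
  subst hψ hg
  have hf := hf_smooth.continuous
  have hc := hφ.continuous_evenExtension
  have hs := hφ.hasCompactSupport_evenExtension
  -- The second argument of `φ` is always a square root or a norm, so passing to the even extension
  -- changes neither `ψ` nor the kernel of `g * φ`.
  have hback : EllipticalRadon.backProj (m := m) lam φ =
      EllipticalRadon.backProj lam (EllipticalRadon.evenExtension φ) := by
    funext x
    simp only [EllipticalRadon.backProj,
      EllipticalRadon.evenExtension_of_nonneg φ _ (Real.sqrt_nonneg _)]
  have hker : EllipticalRadon.radialConvKernel (EllipticalRadon.radonData lam f) φ =
      EllipticalRadon.radialConvKernel (EllipticalRadon.radonData lam f)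
        (EllipticalRadon.evenExtension φ) := by
    funext u w w' u'
    simp only [EllipticalRadon.radialConvKernel,
      EllipticalRadon.evenExtension_of_nonneg φ _ (norm_nonneg _)]
  have hconv := EllipticalRadon.continuous_conv_backProj (lam := lam) hf hf_supp hc hs
  rw [hback]
  refine ⟨fun x => ?_, ?_, hconv.locallyIntegrable, fun u t ht =>
    ⟨(EllipticalRadon.hasDerivAt_radonE hm hlam hf u ht).differentiableAt,
      (EllipticalRadon.hasDerivAt_radonE hm hlam hconv u ht).differentiableAt⟩,
    fun u w hw => ⟨?_, ?_⟩⟩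
  · simpa only [EllipticalRadon.evenExtension_of_nonneg φ _ (Real.sqrt_nonneg _)] using
      EllipticalRadon.integrable_backProj (lam := lam) hc hs x
  · exact hf_supp.convolutionExists_left _ hf
      (EllipticalRadon.continuous_backProj hc hs).locallyIntegrable
  · rw [hker]
    exact EllipticalRadon.integrable_radialConvKernel hm hlam hf hc hs u w
  · have ht : 0 < ‖w‖ := norm_pos_iff.2 hw
    have hC := (EllipticalRadon.jacobian_pos m hlam).ne'
    have htm := (pow_pos ht m).ne'
    rw [EllipticalRadon.partialT_radonE hm hlam hconv u ht,
      ← EllipticalRadon.radialConv_eq hm hlam hf hf_supp hc hs]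
    simp only [EllipticalRadon.radialConv, hker]
    field_simp
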